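/- Let $p>1$ and $\alpha\ge 0$ with $\alpha\ne p-1$. Let $H_0^1(\mathbb N)$ be the space of finitely supported real sequences $u=(u_n)_{n\ge 0}$ with $u_0=0$, and let $\mathcal A^{\mathrm{disc}}_{\alpha,p}$ be the sharp constant, i.e. the largest constant $\mathcal A$ for which $$\sum_{n=1}^\infty |u_n-u_{n-1}|^p\,n^\alpha\ \ge\ \mathcal A\sum_{n=1}^\infty |u_n|^p\,n^{\alpha-p}\qquad\text{for all }u\in H_0^1(\mathbb N).\tag{1.3}$$ Then there is a positive weight $\mathcal R_\alpha:\{1,2,3,\dots\}\to(0,\infty)$ such that for all $u\in H_0^1(\mathbb N)$ $$\sum_{n=1}^\infty |u_n-u_{n-1}|^p\,n^\alpha-\mathcal A^{\mathrm{disc}}_{\alpha,p}\sum_{n=1}^\infty |u_n|^p\,n^{\alpha-p}\ \ge\ \sum_{n=1}^\infty |u_n|^p\,\mathcal R_\alpha(n),$$ and such that (1.3) with $\mathcal A=\mathcal A^{\mathrm{disc}}_{\alpha,p}$ is $(d,\Psi)$-stable for $\Psi(t)=t^p$ and the metric $d(u,v)=\big(\sum_{n\ge1}|u_n-v_n|^p\mathcal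 R_\alpha(n)\big)^{1/p}$ on $H_0^1(\mathbb N)$. In particular, the energy functional $$h_\alpha(u)=\sum_{n=1}^\infty |u_n-u_{n-1}|^p\,n^\alpha-\mathcal A^{\mathrm{disc}}_{\alpha,p}\sum_{n=1}^\infty |u_n|^p\,n^{\alpha-p}$$ is subcritical on $H_0^1(\mathbb N)$, and (1.3) with $\mathcal A=\mathcal A^{\mathrm{disc}}_{\alpha,p}$ is $\Psi$-stable with $\Psi(t)=t^p$. Here a functional $h$ on $H_0^1(\mathbb N)$ is *subcritical* if there is a positive function $w$ on $\mathbb N$ with $h(u)\ge\sum_n|u_n|^pw(n)$ for all $u\in H_0^1(\mathbb N)$. A *rate function* is a strictly convex $\Psi:[0,\infty)\to[0,\infty)$ with $\Psi(0)=0$. For such a $\Psi$ and a metric $d$ on a set $X$, an inequality $\mathcal E(x)\le\mathcal F(x)$ ($x\in X$) between real functionals with a non-empty set of optimizers $X_{\mathrm{opt}}=\{x\in X:\mathcal E(x)=\mathcal F(x)\}$ is *$(d,\Psi)$-stable* if $\mathcal F(x)-\mathcal E(x)\ge\Psi(d(x,X_{\mathrm{opt}}))$ for all $x\in X$; it is *$\Psi$-stable*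 if it is $(d,\Psi)$-stable for some metric $d$ on $X$. For (1.3), $X=H_0^1(\mathbb N)$, $\mathcal E$ is its right-hand side and $\mathcal F$ its left-hand side. -/

import Mathlib

namespace DiscreteHardy

noncomputable section

/-- `C_c(X)` is `X →₀ ℝ`.  The space `H_0^M(ℕ)` of finitely supported real sequences
`(u_n)_{n ≥ 0}` with `u_0 = ⋯ = u_{M-1} = 0`. -/
def H0 (M : ℕ) : Submodule ℝ (ℕ →₀ ℝ) where
  carrier := {u | ∀ i < M, u i = 0}
  zero_mem' := fun _ _ => rfl
  add_mem' := by
    intro u v hu hv i hi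
    simp [hu i hi, hv i hi]
  smul_mem' := by
    intro c u hu i hi
    simp [hu i hi]

/-- `∑_{n ≥ 1} |u_n - u_{n-1}|^p n^α`; the summation index `n` is written `k + 1`, `k ≥ 0`. -/
def kinetic (p α : ℝ) (u : H0 1) : ℝ :=
  ∑' k : ℕ, |u.1 (k + 1) - u.1 k| ^ p * ((k + 1 : ℕ) : ℝ) ^ α

/-- `∑_{n ≥ 1} |u_n|^p w(n)`. -/
def weighted (p : ℝ) (w : ℕ → ℝ) (u : H0 1) : ℝ :=
  ∑' k : ℕ, |u.1 (k + 1)| ^ p * w (k + 1)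

/-- The power weight `n ↦ n^{α-p}`. -/
def hardyWeight (p α : ℝ) (n : ℕ) : ℝ := (n : ℝ) ^ (α - p)

/-- `A^disc_{α,p}`: the sharp (largest) constant `A` in the discrete Hardy inequality
`∑ |u_n - u_{n-1}|^p n^α ≥ A ∑ |u_n|^p n^{α-p}` on `H_0^1(ℕ)`. -/
def Adisc (p α : ℝ) : ℝ :=
  sSup {A : ℝ | ∀ u : H0 1, A * weighted p (hardyWeight p α) u ≤ kinetic p α u}

/-- The Hardy energy functional `h_α` on `H_0^1(ℕ)`. -/
def energy (p α : ℝ) (u : H0 1) : ℝ :=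
  kinetic p α u - Adisc p α * weighted p (hardyWeight p α) u

/-- A functional `h` given on a space `V` of finitely supported functions on `X` is subcritical
if `h(φ) - ∑_x |φ(x)|^p w(x) ≥ 0` on `V` for some positive function `w` on `X`. -/
def IsSubcritical {X : Type*} (p : ℝ) (V : Submodule ℝ (X →₀ ℝ)) (h : V → ℝ) : Prop :=
  ∃ w : X → ℝ, (∀ x, 0 < w x) ∧ ∀ φ : V, 0 ≤ h φ - ∑' x, |φ.1 x| ^ p * w x

/-- A rate function: `[0,∞) → [0,∞)`, strictly convex, vanishing at the origin. -/
def IsRateFunction (Ψ : ℝ → ℝ) : Prop :=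
  (∀ t, 0 ≤ t → 0 ≤ Ψ t) ∧ StrictConvexOn ℝ (Set.Ici 0) Ψ ∧ Ψ 0 = 0

/-- The optimizers of a functional inequality `E ≤ F` (both sides finite). -/
def optimizers {X : Type*} (E F : X → ℝ) : Set X := {x | E x = F x}

/-- The inequality `E ≤ F` holds on `X`, has an optimizer, and is `(d, Ψ)`-stable:
`F x - E x ≥ Ψ (d (x, X_opt))` for every `x`. -/
def IsStableWith {X : Type*} (d : MetricSpace X) (Ψ : ℝ → ℝ) (E F : X → ℝ) : Prop :=
  IsRateFunction Ψ ∧ (∀ x, E x ≤ F x) ∧ (optimizers E F).Nonempty ∧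
    ∀ x, Ψ (Metric.infDist x (optimizers E F)) ≤ F x - E x

/-- `Ψ`-stability: `(d, Ψ)`-stability for some metric `d` on `X`. -/
def IsStable {X : Type*} (Ψ : ℝ → ℝ) (E F : X → ℝ) : Prop :=
  ∃ d : MetricSpace X, IsStableWith d Ψ E F

end

end DiscreteHardy

/-!
Write `γ = (p - 1 - α) / p`. The sharp constant is `|γ| ^ p`, and the inequality with this constant
has room to spare at every `n ≥ 1`.

**Inequality with remainder.** For `0 ≤ y < 1`, convexity of `t ↦ t ^ p` gives
`y ^ (p - 1) * |a| ^ p - (y / (1 - y)) ^ (p - 1) * |b| ^ p ≤ |a - b| ^ p` (`edge_le`). Applied to each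
edge `(n - 1, n)` with its own parameter `y n` and summed, this bounds the kinetic energy from below
by a sum `∑ |u n| ^ p * W n` with an explicit weight `W` (`hardy_of_edges`); `y` plays the role of
`1 - v (n - 1) / v n` (or `1 - v n / v (n - 1)`) for a positive supersolution `v` behaving like
`n ^ γ`. The remainder weight is `R n = W n - |γ| ^ p * n ^ (α - p)`, and the point is to choose `y`
so that positivity of `R` is an elementary inequality in `x = 1 / n ∈ (0, 1]`:

* if `γ > 0`, take `y n = γ / (n - 1 + γ)`; positivity follows from
  `(1 - (1 - γ) x) ^ (1 - p) ≥ exp ((α + γ) x) > (1 + x) ^ α + γ x`;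
* if `β = -γ ∈ (0, 1)`, take `y n = β x (1 - x) ^ (p β / (p - 1))`, for which the leading terms
  telescope exactly to `β ^ p * n ^ (α - p)` and the surplus comes from `(1 - x) ^ β < 1 - β x`;
* if `β ≥ 1`, take `y n = β / (n + β)` and use Bernoulli's inequality for the exponents `1 + β`
  and `β`.

**Sharpness.** The sequences equal to `n ^ γ` for `n ≤ N` and decaying linearly to zero on
`[N, 2 N]` have `∑ |u n| ^ p * n ^ (α - p)` at least the harmonic sum `H N`, and kinetic energy at
most `|γ| ^ p * H N + C` with `C` independent of `N`; since `H N → ∞`, no constant above `|γ| ^ p`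
is admissible (`Adisc_eq`).

**Stability.** `0` is an optimizer, so the distance of `u` to the optimizers is at most the weighted
`ℓ ^ p` norm of `u`, whose `p`-th power is the remainder.
-/

namespace DiscreteHardy

/-! ### Summing one-edge inequalities -/

/-- Convexity of `t ↦ t ^ p` at `|a| ≤ y * (|a - b| / y) + (1 - y) * (|b| / (1 - y))`. -/
theorem edge_le {p y : ℝ} (hp : 1 < p) (hy0 : 0 ≤ y) (hy1 : y < 1) (a b : ℝ) :
    y ^ (p - 1) * |a| ^ p - (y / (1 - y)) ^ (p - 1) * |b| ^ p ≤ |a - b| ^ p := by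
  rcases hy0.eq_or_lt with rfl | hy
  · rw [Real.zero_rpow (by linarith), zero_div, Real.zero_rpow (by linarith)]
    simpa using Real.rpow_nonneg (abs_nonneg (a - b)) p
  have hz : 0 < 1 - y := by linarith
  have hab : |a| ≤ |a - b| + |b| := by simpa using abs_add_le (a - b) b
  have hconv := (convexOn_rpow hp.le).2 (x := |a - b| / y) (Set.mem_Ici.2 (by positivity))
    (y := |b| / (1 - y)) (Set.mem_Ici.2 (by positivity)) hy.le hz.le (by ring)
  simp only [smul_eq_mul] at hconv
  rw [mul_div_cancel₀ _ hy.ne', mul_div_cancel₀ _ hz.ne', Real.div_rpow (abs_nonneg _) hy.le,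
    Real.div_rpow (abs_nonneg _) hz.le] at hconv
  have h1 : |a| ^ p ≤ (|a - b| + |b|) ^ p := by gcongr
  have h2 := mul_le_mul_of_nonneg_left (h1.trans hconv) (Real.rpow_nonneg hy.le (p - 1))
  have hyp : y ^ p = y ^ (p - 1) * y := by
    rw [← Real.rpow_add_one hy.ne']; ring_nf
  have hzp : (1 - y) ^ p = (1 - y) ^ (p - 1) * (1 - y) := by
    rw [← Real.rpow_add_one hz.ne']; ring_nf
  have hyq : 0 < y ^ (p - 1) := Real.rpow_pos_of_pos hy _
  have hzq : 0 < (1 - y) ^ (p - 1) := Real.rpow_pos_of_pos hz _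
  have h3 : y ^ (p - 1) * (y * (|a - b| ^ p / y ^ p) + (1 - y) * (|b| ^ p / (1 - y) ^ p))
      = |a - b| ^ p + (y / (1 - y)) ^ (p - 1) * |b| ^ p := by
    rw [hyp, hzp, Real.div_rpow hy.le hz.le]
    field_simp
  linarith

theorem summable_shift {p : ℝ} (hp : 1 < p) (u : H0 1) (w : ℕ → ℝ) :
    Summable fun k : ℕ => |u.1 (k + 1)| ^ p * w (k + 1) := by
  refine summable_of_hasFiniteSupport (((u.1.hasFiniteSupport).preimage
    (Nat.succ_injective.injOn)).subset fun k hk => ?_)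
  contrapose! hk
  have : u.1 (k + 1) = 0 := by simpa using hk
  simp [this, Real.zero_rpow (by linarith : p ≠ 0)]

theorem summable_pow_mul {p : ℝ} (hp : 1 < p) (u : H0 1) (w : ℕ → ℝ) :
    Summable fun k : ℕ => |u.1 k| ^ p * w k :=
  (summable_nat_add_iff 1).1 (summable_shift hp u w)

theorem summable_kinetic {p : ℝ} (hp : 1 < p) (α : ℝ) (u : H0 1) :
    Summable fun k : ℕ => |u.1 (k + 1) - u.1 k| ^ p * ((k + 1 : ℕ) : ℝ) ^ α := by
  refine summable_of_hasFiniteSupport ((((u.1.hasFiniteSupport).preimage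
    (Nat.succ_injective.injOn)).union u.1.hasFiniteSupport).subset fun k hk => ?_)
  contrapose! hk
  simp only [Set.mem_union, Set.mem_preimage, Function.mem_support, not_or, not_not] at hk
  obtain ⟨h1, h2⟩ := hk
  have h1 : u.1 (k + 1) = 0 := h1
  simp [h1, h2, Real.zero_rpow (by linarith : p ≠ 0)]

theorem apply_zero (u : H0 1) : u.1 0 = 0 := u.2 0 one_pos

theorem weighted_nonneg (p : ℝ) {R : ℕ → ℝ} (hR : ∀ n, 1 ≤ n → 0 < R n) (u : H0 1) :
    0 ≤ weighted p R u :=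
  tsum_nonneg fun k => mul_nonneg (by positivity) (hR _ (by omega)).le

/-- Inequalities on the single edges `(n - 1, n)` add up, after a shift of the index in the
`|u (n - 1)| ^ p` terms (`u 0 = 0`), to a Hardy inequality with weight `P n - Q (n + 1)`; here the
part `K * n ^ (α - p)` of this weight is split off. -/
theorem hardy_of_edges {p α K : ℝ} (hp : 1 < p) (P Q : ℕ → ℝ)
    (hedge : ∀ (u : H0 1) (k : ℕ), P (k + 1) * |u.1 (k + 1)| ^ p - Q (k + 1) * |u.1 k| ^ p ≤
      |u.1 (k + 1) - u.1 k| ^ p * ((k + 1 : ℕ) : ℝ) ^ α) (u : H0 1) :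
    K * weighted p (hardyWeight p α) u
      + weighted p (fun n => P n - Q (n + 1) - K * hardyWeight p α n) u ≤ kinetic p α u := by
  have hP := summable_shift hp u P
  have hQ := summable_pow_mul hp u fun k => Q (k + 1)
  have hQ' := summable_shift hp u fun k => Q (k + 1)
  have hW := summable_shift hp u (hardyWeight p α)
  have hQ0 : ∑' k : ℕ, |u.1 k| ^ p * Q (k + 1) = ∑' k : ℕ, |u.1 (k + 1)| ^ p * Q (k + 1 + 1) := by
    rw [hQ.tsum_eq_zero_add, apply_zero, abs_zero, Real.zero_rpow (by linarith)]
    simp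
  have hsum : ∑' k : ℕ, (|u.1 (k + 1)| ^ p * P (k + 1) - |u.1 k| ^ p * Q (k + 1)) ≤
      kinetic p α u :=
    (hP.sub hQ).tsum_le_tsum (fun k => by have := hedge u k; linarith) (summable_kinetic hp α u)
  rw [hP.tsum_sub hQ, hQ0, ← hP.tsum_sub hQ'] at hsum
  refine le_trans (le_of_eq ?_) hsum
  rw [weighted, weighted, ← tsum_mul_left,
    ← (hW.mul_left K).tsum_add (summable_shift hp u
      fun n => P n - Q (n + 1) - K * hardyWeight p α n)]
  exact tsum_congr fun k => by ring

/-! ### The Hardy inequality with a positive remainder -/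

/-- Positivity of the remainder for `α < p - 1`, in the variable `x = 1 / n`. Both sides are compared
with `exp ((α + γ) * x)`, using `(1 - γ) * (p - 1) = α + γ`. -/
theorem one_add_rpow_lt_of_pos {p α : ℝ} (hp : 1 < p) (hα : 0 ≤ α) (h : α < p - 1)
    {γ : ℝ} (hγ : p * γ = p - 1 - α) {x : ℝ} (hx : 0 < x) (hx1 : x ≤ 1) :
    (1 + x) ^ α + γ * x < (1 - (1 - γ) * x) ^ (1 - p) := by
  have hγ0 : 0 < γ := by by_contra! h'; nlinarith
  have hγ1 : γ < 1 := by by_contra! h'; nlinarith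
  have hpos : 0 < 1 - (1 - γ) * x := by nlinarith
  have h1 : Real.exp ((α + γ) * x) ≤ (1 - (1 - γ) * x) ^ (1 - p) := by
    have := Real.rpow_le_rpow_of_nonpos hpos
      (by linarith [Real.add_one_le_exp (-((1 - γ) * x))] :
        1 - (1 - γ) * x ≤ Real.exp (-((1 - γ) * x))) (by linarith : 1 - p ≤ 0)
    rw [← Real.exp_mul] at this
    refine le_trans (le_of_eq ?_) this
    congr 1
    linear_combination x * hγ
  have h2 : (1 + x) ^ α ≤ Real.exp (α * x) := by
    rw [mul_comm, Real.exp_mul]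
    exact Real.rpow_le_rpow (by linarith) (by linarith [Real.add_one_le_exp x]) hα
  have h3 : 1 + γ * x < Real.exp (γ * x) := by
    linarith [Real.add_one_lt_exp (x := γ * x) (by positivity)]
  have h4 : 1 ≤ (1 + x) ^ α := Real.one_le_rpow (by linarith) hα
  have h5 : Real.exp ((α + γ) * x) = Real.exp (α * x) * Real.exp (γ * x) := by
    rw [← Real.exp_add]; ring_nf
  have h6 : 0 < γ * x := by positivity
  nlinarith [mul_le_mul_of_nonneg_right h2 (Real.exp_pos (γ * x)).le]

/-- The case `0 < γ < 1`, with the supersolution `v n = Γ(n + γ) / Γ(n)`. -/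
theorem exists_hardy_of_pos {p α : ℝ} (hp : 1 < p) (hα : 0 ≤ α) (h : α < p - 1)
    {γ : ℝ} (hγ : p * γ = p - 1 - α) :
    ∃ R : ℕ → ℝ, (∀ n, 1 ≤ n → 0 < R n) ∧ ∀ u : H0 1,
      |γ| ^ p * weighted p (hardyWeight p α) u + weighted p R u ≤ kinetic p α u := by
  have hγ0 : 0 < γ := by by_contra! h'; nlinarith
  have hγ1 : γ < 1 := by by_contra! h'; nlinarith
  set y : ℕ → ℝ := fun n => γ / (n - 1 + γ) with hy
  refine ⟨_, fun n hn => ?_, hardy_of_edges hp (fun n => (n : ℝ) ^ α * y n ^ (p - 1))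
    (fun n => (n : ℝ) ^ α * (y n / (1 - y n)) ^ (p - 1)) fun u k => ?_⟩
  · have hn1 : (1 : ℝ) ≤ n := by exact_mod_cast hn
    have hn0 : (0 : ℝ) < n := by linarith
    have key := one_add_rpow_lt_of_pos hp hα h hγ (x := 1 / n) (by positivity)
      (by rw [div_le_one hn0]; exact hn1)
    have e1 : y n ^ (p - 1) =
        γ ^ (p - 1) * (n : ℝ) ^ (1 - p) * (1 - (1 - γ) * (1 / n)) ^ (1 - p) := by
      have hq : (0 : ℝ) < n - 1 + γ := by linarith
      have : 1 - (1 - γ) * (1 / (n : ℝ)) = (n - 1 + γ) / n := by field_simp; ring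
      rw [this, hy]
      simp only
      rw [mul_assoc, ← Real.mul_rpow hn0.le (by positivity), mul_div_cancel₀ _ hn0.ne',
        Real.div_rpow hγ0.le hq.le, ← neg_sub p 1, Real.rpow_neg hq.le, div_eq_mul_inv]
    have e2 : y (n + 1) / (1 - y (n + 1)) = γ / n := by
      have hq : (0 : ℝ) < n + γ := by linarith
      simp only [hy]
      push_cast
      rw [add_sub_cancel_right]
      have : 1 - γ / (n + γ) = n / (n + γ) := by field_simp; ring
      rw [this]; field_simp
    have e3 : (γ / (n : ℝ)) ^ (p - 1) = γ ^ (p - 1) * (n : ℝ) ^ (1 - p) := by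
      rw [Real.div_rpow hγ0.le hn0.le, ← neg_sub p 1, Real.rpow_neg hn0.le, div_eq_mul_inv]
    have e4 : ((n + 1 : ℕ) : ℝ) ^ α = (n : ℝ) ^ α * (1 + 1 / n) ^ α := by
      rw [← Real.mul_rpow hn0.le (by positivity)]
      congr 1; push_cast; field_simp
    have e5 : hardyWeight p α n = (n : ℝ) ^ α * (n : ℝ) ^ (1 - p) * (1 / n) := by
      rw [hardyWeight, ← Real.rpow_add hn0, one_div, ← Real.rpow_neg_one (n : ℝ),
        ← Real.rpow_add hn0]
      ring_nf
    have e6 : |γ| ^ p = γ ^ (p - 1) * γ := by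
      rw [abs_of_pos hγ0, ← Real.rpow_add_one hγ0.ne']; ring_nf
    simp only [e1, e2, e3, e4, e5, e6]
    have hc : 0 < (n : ℝ) ^ α * γ ^ (p - 1) * (n : ℝ) ^ (1 - p) := by positivity
    have := mul_pos hc (sub_pos.2 key)
    linarith
  · rcases Nat.eq_zero_or_pos k with rfl | hk
    -- On the first edge `y 1 = 1`, so `edge_le` does not apply, but there `u 0 = 0`.
    · simp [apply_zero, hy, hγ0.ne', Real.zero_rpow (by linarith : p ≠ 0)]
    · have hk0 : (0 : ℝ) < k := by exact_mod_cast hk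
      have := edge_le hp (y := y (k + 1)) (by simp only [hy]; push_cast; rw [add_sub_cancel_right]; positivity)
        (by simp only [hy]; push_cast; rw [add_sub_cancel_right, div_lt_one (by positivity)]; linarith)
        (u.1 (k + 1)) (u.1 k)
      have := mul_le_mul_of_nonneg_left this
        (Real.rpow_nonneg (Nat.cast_nonneg (α := ℝ) (k + 1)) α)
      linarith

/-- The version of `hardy_of_edges` for `α > p - 1`, where the supersolution decreases and `edge_le` is
used on the edge `(n - 1, n)` with the roles `a = u (n - 1)` and `b = u n`. -/
theorem exists_hardy_of_decreasing {p α K : ℝ} (hp : 1 < p) (y : ℕ → ℝ)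
    (hy : ∀ n, 1 ≤ n → 0 ≤ y n ∧ y n < 1)
    (hK : ∀ n : ℕ, 1 ≤ n → K * (n : ℝ) ^ (α - p) <
      ((n : ℝ) + 1) ^ α * y (n + 1) ^ (p - 1) - (n : ℝ) ^ α * (y n / (1 - y n)) ^ (p - 1)) :
    ∃ R : ℕ → ℝ, (∀ n, 1 ≤ n → 0 < R n) ∧ ∀ u : H0 1,
      K * weighted p (hardyWeight p α) u + weighted p R u ≤ kinetic p α u := by
  refine ⟨_, fun n hn => ?_, hardy_of_edges hp
    (fun n => -((n : ℝ) ^ α * (y n / (1 - y n)) ^ (p - 1)))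
    (fun n => -((n : ℝ) ^ α * y n ^ (p - 1))) fun u k => ?_⟩
  · have := hK n hn
    simp only [hardyWeight]
    push_cast
    linarith
  · obtain ⟨h0, h1⟩ := hy (k + 1) (by omega)
    have := mul_le_mul_of_nonneg_left (edge_le hp h0 h1 (u.1 k) (u.1 (k + 1)))
      (Real.rpow_nonneg (Nat.cast_nonneg (α := ℝ) (k + 1)) α)
    rw [abs_sub_comm] at this
    linarith

/-- The case `-1 < γ < 0`, where Bernoulli's inequality for the concave power `β = -γ` applies. -/
theorem exists_hardy_of_neg_of_lt_one {p α : ℝ} (hp : 1 < p)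
    {β : ℝ} (hβ : p * β = α + 1 - p) (hβ0 : 0 < β) (hβ1 : β < 1) :
    ∃ R : ℕ → ℝ, (∀ n, 1 ≤ n → 0 < R n) ∧ ∀ u : H0 1,
      β ^ p * weighted p (hardyWeight p α) u + weighted p R u ≤ kinetic p α u := by
  have hp1 : 0 < p - 1 := by linarith
  have hpβ : 0 < p * β := by positivity
  have hx : ∀ n : ℕ, 1 ≤ n → 0 < 1 / (n : ℝ) ∧ 1 / (n : ℝ) ≤ 1 := fun n hn => by
    have hn1 : (1 : ℝ) ≤ n := by exact_mod_cast hn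
    exact ⟨by positivity, by rw [div_le_one (by linarith)]; exact hn1⟩
  set y : ℕ → ℝ := fun n => β * (1 / n) * (1 - 1 / n) ^ (p * β / (p - 1)) with hy
  have hyn : ∀ n : ℕ, 1 ≤ n → 0 ≤ y n ∧ y n ≤ β * (1 / n) := fun n hn => by
    obtain ⟨h0, h1⟩ := hx n hn
    have hz : 0 ≤ 1 - 1 / (n : ℝ) := by linarith
    refine ⟨by positivity, mul_le_of_le_one_right (by positivity) ?_⟩
    exact Real.rpow_le_one hz (by linarith) (by positivity)
  have hβx : ∀ n : ℕ, 1 ≤ n → β * (1 / (n : ℝ)) < 1 := fun n hn => by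
    obtain ⟨h0, h1⟩ := hx n hn
    nlinarith
  have hypow : ∀ n : ℕ, 1 ≤ n →
      y n ^ (p - 1) = (β * (1 / n)) ^ (p - 1) * (1 - 1 / n) ^ (p * β) := fun n hn => by
    obtain ⟨h0, h1⟩ := hx n hn
    have hz : 0 ≤ 1 - 1 / (n : ℝ) := by linarith
    rw [hy]
    simp only
    rw [Real.mul_rpow (by positivity) (by positivity), ← Real.rpow_mul hz,
      div_mul_cancel₀ _ hp1.ne']
  refine exists_hardy_of_decreasing hp y
    (fun n hn => ⟨(hyn n hn).1, (hyn n hn).2.trans_lt (hβx n hn)⟩) fun n hn => ?_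
  obtain ⟨hx0, hx1⟩ := hx n hn
  have hn0 : (0 : ℝ) < n := by exact_mod_cast hn
  have hz : 0 ≤ 1 - 1 / (n : ℝ) := by linarith
  have hw : 0 < 1 - β * (1 / (n : ℝ)) := by linarith [hβx n hn]
  -- Bernoulli's inequality for the concave power `β < 1`.
  have hbern : (1 - 1 / (n : ℝ)) ^ β < 1 - β * (1 / n) := by
    have := rpow_one_add_lt_one_add_mul_self (s := -(1 / (n : ℝ))) (by linarith)
      (by linarith) hβ0 hβ1
    simpa [sub_eq_add_neg] using this
  -- This strict inequality is the source of the remainder: with the right side in place of the left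
  -- the weight would be exactly `β ^ p * n ^ (α - p)`, see `hA` and `hC`.
  have hB : (y n / (1 - y n)) ^ (p - 1) < (β * (1 / n)) ^ (p - 1) * (1 - β * (1 / n)) := by
    rw [Real.div_rpow (hyn n hn).1 (by linarith [hyn n hn]), hypow n hn,
      div_lt_iff₀ (Real.rpow_pos_of_pos (by linarith [hyn n hn]) _), mul_assoc]
    refine mul_lt_mul_of_pos_left ?_ (by positivity)
    calc (1 - 1 / (n : ℝ)) ^ (p * β) = ((1 - 1 / (n : ℝ)) ^ β) ^ p := by
          rw [← Real.rpow_mul hz, mul_comm]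
      _ < (1 - β * (1 / n)) ^ p := Real.rpow_lt_rpow (by positivity) hbern (by linarith)
      _ = (1 - β * (1 / n)) * (1 - β * (1 / n)) ^ (p - 1) := by
          rw [mul_comm (1 - β * (1 / (n : ℝ))), ← Real.rpow_add_one hw.ne']; ring_nf
      _ ≤ (1 - β * (1 / n)) * (1 - y n) ^ (p - 1) := by
          gcongr
          exact (hyn n hn).2
  have hA : ((n : ℝ) + 1) ^ α * y (n + 1) ^ (p - 1) = β ^ (p - 1) * (n : ℝ) ^ (p * β) := by
    have hm : (0 : ℝ) < n + 1 := by linarith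
    rw [hypow _ (by omega)]
    push_cast
    have : 1 - 1 / ((n : ℝ) + 1) = n / (n + 1) := by field_simp; ring
    rw [this, mul_one_div, Real.div_rpow hβ0.le hm.le, Real.div_rpow hn0.le hm.le]
    have : ((n : ℝ) + 1) ^ α = ((n : ℝ) + 1) ^ (p - 1) * ((n : ℝ) + 1) ^ (p * β) := by
      rw [← Real.rpow_add hm, hβ]; ring_nf
    rw [this]
    field_simp
  have hC : (n : ℝ) ^ α * ((β * (1 / n)) ^ (p - 1) * (1 - β * (1 / n))) =
      β ^ (p - 1) * (n : ℝ) ^ (p * β) - β ^ p * (n : ℝ) ^ (α - p) := by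
    have h1 : (n : ℝ) ^ α = (n : ℝ) ^ (p - 1) * (n : ℝ) ^ (p * β) := by
      rw [← Real.rpow_add hn0, hβ]; ring_nf
    have h2 : (n : ℝ) ^ (p * β) = (n : ℝ) ^ (α - p) * n := by
      rw [← Real.rpow_add_one hn0.ne', hβ]; ring_nf
    have h3 : β ^ p = β ^ (p - 1) * β := by
      rw [← Real.rpow_add_one hβ0.ne']; ring_nf
    rw [h1, mul_one_div, Real.div_rpow hβ0.le hn0.le, h2, h3]
    field_simp
  rw [hA]
  have := mul_lt_mul_of_pos_left hB (Real.rpow_pos_of_pos hn0 α)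
  linarith

/-- The case `γ ≤ -1`, where Bernoulli's inequality for the convex powers `β = -γ` and `1 + β`
applies. -/
theorem exists_hardy_of_neg_of_one_le {p α : ℝ} (hp : 1 < p)
    {β : ℝ} (hβ : p * β = α + 1 - p) (hβ1 : 1 ≤ β) :
    ∃ R : ℕ → ℝ, (∀ n, 1 ≤ n → 0 < R n) ∧ ∀ u : H0 1,
      β ^ p * weighted p (hardyWeight p α) u + weighted p R u ≤ kinetic p α u := by
  have hβ0 : 0 < β := by linarith
  refine exists_hardy_of_decreasing hp (fun n => β / (n + β))
    (fun n hn => ⟨by positivity, ?_⟩) fun n hn => ?_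
  · have hn0 : (0 : ℝ) < n := by exact_mod_cast hn
    rw [div_lt_one (by positivity)]; linarith
  have hn0 : (0 : ℝ) < n := by exact_mod_cast hn
  have hx : (0 : ℝ) < 1 / n := by positivity
  set x : ℝ := 1 / n with hxdef
  have h1 : 1 + β * x ≤ (1 + x) ^ β :=
    one_add_mul_self_le_rpow_one_add (by linarith) hβ1
  have h2 : 1 + (1 + β) * x < (1 + x) ^ (1 + β) :=
    one_add_mul_self_lt_rpow_one_add (by linarith) hx.ne' (by linarith)
  have h3 : (1 + (1 + β) * x) ^ (p - 1) * (1 + β * x) < (1 + x) ^ α := by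
    calc _ < ((1 + x) ^ (1 + β)) ^ (p - 1) * (1 + β * x) := by
          have := Real.rpow_lt_rpow (by positivity) h2 (by linarith : 0 < p - 1)
          gcongr
      _ ≤ ((1 + x) ^ (1 + β)) ^ (p - 1) * (1 + x) ^ β := by gcongr
      _ = (1 + x) ^ α := by
          rw [← Real.rpow_mul (by positivity), ← Real.rpow_add (by positivity)]
          congr 1
          linear_combination hβ
  have hn1 : (n : ℝ) + 1 = n * (1 + x) := by rw [hxdef]; field_simp
  have hn2 : ((n + 1 : ℕ) : ℝ) + β = n * (1 + (1 + β) * x) := by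
    push_cast; rw [hxdef]; field_simp; ring
  have hs : β / (n + β) / (1 - β / (n + β)) = β / n := by
    have : 1 - β / (n + β) = n / (n + β) := by field_simp; ring
    rw [this]; field_simp
  have hr : (n : ℝ) ^ α * (n : ℝ) ^ (1 - p) = (n : ℝ) ^ (α - p) * n := by
    rw [← Real.rpow_add hn0, ← Real.rpow_add_one hn0.ne']; ring_nf
  have hnq : ((n : ℝ) ^ (p - 1))⁻¹ = (n : ℝ) ^ (1 - p) := by
    rw [← Real.rpow_neg hn0.le]; ring_nf
  have hβp : β ^ p = β ^ (p - 1) * β := by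
    rw [← Real.rpow_add_one hβ0.ne']; ring_nf
  have hD : 0 < (1 + (1 + β) * x) ^ (p - 1) := by positivity
  rw [hs, hn2, hn1, Real.mul_rpow hn0.le (by positivity), Real.div_rpow hβ0.le (by positivity),
    Real.mul_rpow hn0.le (by positivity), Real.div_rpow hβ0.le hn0.le, hβp]
  have h4 : 1 + β * x < (1 + x) ^ α / (1 + (1 + β) * x) ^ (p - 1) := by
    rw [lt_div_iff₀ hD]; linarith
  have hc : 0 < β ^ (p - 1) * ((n : ℝ) ^ (α - p) * n) := by positivity
  have h5 := mul_lt_mul_of_pos_left h4 hc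
  have e1 : (n : ℝ) ^ α * (1 + x) ^ α * (β ^ (p - 1) / ((n : ℝ) ^ (p - 1) * (1 + (1 + β) * x) ^ (p - 1)))
      = β ^ (p - 1) * ((n : ℝ) ^ (α - p) * n) * ((1 + x) ^ α / (1 + (1 + β) * x) ^ (p - 1)) := by
    rw [← hr, ← hnq]; field_simp
  have e2 : (n : ℝ) ^ α * (β ^ (p - 1) / (n : ℝ) ^ (p - 1))
      = β ^ (p - 1) * ((n : ℝ) ^ (α - p) * n) := by
    rw [← hr, ← hnq]; field_simp
  have e3 : (n : ℝ) * x = 1 := by rw [hxdef]; field_simp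
  rw [e1, e2]
  have e4 : β ^ (p - 1) * ((n : ℝ) ^ (α - p) * n) * (1 + β * x) =
      β ^ (p - 1) * ((n : ℝ) ^ (α - p) * n) + β ^ (p - 1) * β * (n : ℝ) ^ (α - p) := by
    linear_combination β ^ (p - 1) * (n : ℝ) ^ (α - p) * β * e3
  linarith

theorem exists_hardy {p α : ℝ} (hp : 1 < p) (hα : 0 ≤ α) (hαp : α ≠ p - 1) :
    ∃ R : ℕ → ℝ, (∀ n, 1 ≤ n → 0 < R n) ∧ ∀ u : H0 1,
      |(p - 1 - α) / p| ^ p * weighted p (hardyWeight p α) u + weighted p R u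
        ≤ kinetic p α u := by
  have hp0 : p ≠ 0 := by linarith
  have hγ : p * ((p - 1 - α) / p) = p - 1 - α := by field_simp
  rcases hαp.lt_or_gt with h | h
  · exact exists_hardy_of_pos hp hα h hγ
  · set γ := (p - 1 - α) / p
    have hγ0 : γ < 0 := by by_contra! h'; nlinarith
    rw [abs_of_neg hγ0]
    rcases lt_or_ge (-γ) 1 with h1 | h1
    · exact exists_hardy_of_neg_of_lt_one hp (by linarith) (by linarith) h1
    · exact exists_hardy_of_neg_of_one_le hp (by linarith) h1


/-! ### Sharpness of the constant -/

/-- The power `n ^ γ` for `n ≤ N`, continued by linear decay to zero at `n = 2 * N`. The truncated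
subtraction makes it vanish for `n ≥ 2 * N`. -/
noncomputable def trialFun (γ : ℝ) (N n : ℕ) : ℝ :=
  if n ≤ N then (n : ℝ) ^ γ else (N : ℝ) ^ γ * ((2 * N - n : ℕ) : ℝ) / N

/-- `trialFun` as an element of `H_0^1(ℕ)`; it vanishes at `n = 0` because `0 ^ γ = 0` for real
exponents `γ ≠ 0`, of either sign. -/
noncomputable def trial (γ : ℝ) (hγ : γ ≠ 0) (N : ℕ) : H0 1 :=
  ⟨Finsupp.onFinset (Finset.range (2 * N)) (trialFun γ N) fun n hn => by
    contrapose! hn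
    rw [Finset.mem_range, not_lt] at hn
    rw [trialFun]
    split_ifs with h
    · have : n = 0 := by omega
      simp [this, Real.zero_rpow hγ]
    · simp [Nat.sub_eq_zero_of_le hn], fun i hi => by
    obtain rfl : i = 0 := by omega
    simp [trialFun, Real.zero_rpow hγ]⟩

@[simp] theorem trial_apply (γ : ℝ) (hγ : γ ≠ 0) (N n : ℕ) :
    (trial γ hγ N).1 n = trialFun γ N n := rfl

theorem abs_trialFun_succ_sub_of_ge {γ : ℝ} {N n : ℕ} (hN : 1 ≤ N) (h : N ≤ n) :
    |trialFun γ N (n + 1) - trialFun γ N n| ≤ (N : ℝ) ^ (γ - 1) := by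
  have hN0 : (0 : ℝ) < N := by exact_mod_cast hN
  have key : ∀ m, N ≤ m → trialFun γ N m = (N : ℝ) ^ (γ - 1) * ((2 * N - m : ℕ) : ℝ) := by
    intro m hm
    rw [trialFun, Real.rpow_sub_one hN0.ne']
    split_ifs with h'
    · obtain rfl : m = N := le_antisymm h' hm
      have : 2 * m - m = m := by omega
      rw [this]; field_simp
    · ring
  rw [key _ h, key _ (by omega), ← mul_sub, abs_mul, abs_of_pos (by positivity)]
  refine mul_le_of_le_one_right (by positivity) ?_
  rcases le_or_gt (2 * N) n with h2 | h2
  · simp [Nat.sub_eq_zero_of_le h2, Nat.sub_eq_zero_of_le (h2.trans (Nat.le_succ n))]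
  · have : ((2 * N - n : ℕ) : ℝ) = ((2 * N - (n + 1) : ℕ) : ℝ) + 1 := by
      exact_mod_cast (by omega : 2 * N - n = 2 * N - (n + 1) + 1)
    rw [this]; simp

theorem abs_rpow_succ_sub_le {γ : ℝ} (hγ : γ ≤ 1) {x : ℝ} (hx : 0 < x) :
    |(x + 1) ^ γ - x ^ γ| ≤ |γ| * x ^ (γ - 1) := by
  have := (convex_Icc x (x + 1)).norm_image_sub_le_of_norm_hasDerivWithin_le
    (f := fun t => t ^ γ) (f' := fun t => γ * t ^ (γ - 1)) (C := |γ| * x ^ (γ - 1))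
    (x := x) (y := x + 1)
    (fun t ht => (Real.hasDerivAt_rpow_const (Or.inl (by linarith [ht.1]))).hasDerivWithinAt)
    (fun t ht => ?_) (by simp) (by simp)
  · simpa using this
  · have ht0 : 0 < t := hx.trans_le ht.1
    rw [norm_mul, Real.norm_eq_abs, Real.norm_eq_abs, abs_of_pos (Real.rpow_pos_of_pos ht0 _)]
    exact mul_le_mul_of_nonneg_left
      (Real.rpow_le_rpow_of_nonpos hx ht.1 (by linarith)) (abs_nonneg _)

theorem one_add_rpow_le {α x : ℝ} (hα : 0 ≤ α) (hx : 0 ≤ x) (hx1 : x ≤ 1) :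
    (1 + x) ^ α ≤ 1 + α * Real.exp α * x := by
  have h1 : (1 + x) ^ α ≤ Real.exp (α * x) := by
    rw [mul_comm, Real.exp_mul]
    exact Real.rpow_le_rpow (by linarith) (by linarith [Real.add_one_le_exp x]) hα
  have h2 : Real.exp (α * x) * (1 - α * x) ≤ 1 := by
    have := mul_le_mul_of_nonneg_left (Real.add_one_le_exp (-(α * x))) (Real.exp_pos (α * x)).le
    rw [← Real.exp_add, add_neg_cancel, Real.exp_zero] at this
    linarith
  have h3 : Real.exp (α * x) ≤ Real.exp α := Real.exp_le_exp.2 (by nlinarith)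
  have h4 := mul_le_mul_of_nonneg_left h3 (by positivity : 0 ≤ α * x)
  linarith

/-- The kinetic energy of the trial sequence. The three summands come from the first edge, the edges
up to `N`, where `p * (γ - 1) + α = -1` produces the harmonic sum, and the linear decay. -/
theorem kinetic_trial_le {p α : ℝ} (hp : 1 < p) (hα : 0 ≤ α) {γ : ℝ} (hγ : p * γ = p - 1 - α)
    (hγ0 : γ ≠ 0) {N : ℕ} (hN : 1 ≤ N) :
    kinetic p α (trial γ hγ0 N) ≤ 1 + |γ| ^ p * (∑ k ∈ Finset.range N, 1 / ((k : ℝ) + 1) +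
      α * Real.exp α * ∑' k : ℕ, 1 / ((k : ℝ) + 1) ^ 2) + 2 ^ α := by
  have hp0 : 0 < p := by linarith
  have hN0 : (0 : ℝ) < N := by exact_mod_cast hN
  have hγ1 : γ ≤ 1 := by by_contra! h; nlinarith
  have hsq : Summable fun k : ℕ => 1 / ((k : ℝ) + 1) ^ 2 := by
    simpa using (summable_nat_add_iff 1).2 (Real.summable_one_div_nat_pow.2 one_lt_two)
  rw [kinetic, tsum_eq_sum (s := Finset.range (N + N)), Finset.sum_range_add]
  swap
  · intro k hk
    rw [Finset.mem_range, not_lt] at hk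
    have h1 : trialFun γ N (k + 1) = 0 := by
      rw [trialFun, if_neg (by omega), Nat.sub_eq_zero_of_le (by omega)]; simp
    have h2 : trialFun γ N k = 0 := by
      rw [trialFun, if_neg (by omega), Nat.sub_eq_zero_of_le (by omega)]; simp
    simp [h1, h2, Real.zero_rpow hp0.ne']
  refine add_le_add ?_ ?_
  · obtain ⟨M, rfl⟩ : ∃ M, N = M + 1 := ⟨N - 1, by omega⟩
    have hfirst : |(trial γ hγ0 (M + 1)).1 (0 + 1) - (trial γ hγ0 (M + 1)).1 0| ^ p *
        ((0 + 1 : ℕ) : ℝ) ^ α = 1 := by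
      simp [trialFun, Real.zero_rpow hγ0]
    rw [Finset.sum_range_succ', hfirst, add_comm]
    gcongr
    have hterm : ∀ k ∈ Finset.range M, |(trial γ hγ0 (M + 1)).1 (k + 1 + 1) -
        (trial γ hγ0 (M + 1)).1 (k + 1)| ^ p * ((k + 1 + 1 : ℕ) : ℝ) ^ α ≤
        |γ| ^ p * (1 / ((k : ℝ) + 1) + α * Real.exp α * (1 / ((k : ℝ) + 1) ^ 2)) := by
      intro k hk
      rw [Finset.mem_range] at hk
      simp only [trial_apply]
      rw [trialFun, trialFun, if_pos (by omega), if_pos (by omega)]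
      have hx : (0 : ℝ) < (k + 1 : ℕ) := by positivity
      have hk1 : (k : ℝ) + 1 = ((k + 1 : ℕ) : ℝ) := by push_cast; rfl
      have hk2 : ((k + 1 + 1 : ℕ) : ℝ) = ((k + 1 : ℕ) : ℝ) + 1 := by push_cast; rfl
      have hx1 : (1 : ℝ) ≤ (k + 1 : ℕ) := by exact_mod_cast Nat.succ_le_succ (Nat.zero_le k)
      rw [hk1, hk2]
      generalize ((k + 1 : ℕ) : ℝ) = x at hx hx1
      have h1 : |(x + 1) ^ γ - x ^ γ| ^ p ≤ (|γ| * x ^ (γ - 1)) ^ p :=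
        Real.rpow_le_rpow (abs_nonneg _) (abs_rpow_succ_sub_le hγ1 hx) hp0.le
      have h2 : (x + 1) ^ α = x ^ α * (1 + 1 / x) ^ α := by
        rw [← Real.mul_rpow hx.le (by positivity)]; congr 1; field_simp
      have h3 := one_add_rpow_le hα (by positivity : 0 ≤ 1 / x) ((div_le_one hx).2 hx1)
      have h4 : x ^ ((γ - 1) * p) * x ^ α = 1 / x := by
        rw [← Real.rpow_add hx, one_div, ← Real.rpow_neg_one]
        congr 1; linear_combination hγ
      calc _ ≤ (|γ| * x ^ (γ - 1)) ^ p * (x + 1) ^ α := by gcongr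
        _ = |γ| ^ p * (1 / x * (1 + 1 / x) ^ α) := by
          rw [Real.mul_rpow (abs_nonneg _) (by positivity), ← Real.rpow_mul hx.le, h2, ← h4]
          ring
        _ ≤ |γ| ^ p * (1 / x * (1 + α * Real.exp α * (1 / x))) := by gcongr
        _ = _ := by ring
    refine (Finset.sum_le_sum hterm).trans ?_
    rw [← Finset.mul_sum, Finset.sum_add_distrib, ← Finset.mul_sum]
    have hmono : ∑ k ∈ Finset.range M, 1 / ((k : ℝ) + 1) ≤
        ∑ k ∈ Finset.range (M + 1), 1 / ((k : ℝ) + 1) :=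
      Finset.sum_le_sum_of_subset_of_nonneg (Finset.range_mono M.le_succ)
        fun _ _ _ => by positivity
    gcongr
    exact hsq.sum_le_tsum _ fun _ _ => by positivity
  · have hterm : ∀ k ∈ Finset.range N, |(trial γ hγ0 N).1 (N + k + 1) -
        (trial γ hγ0 N).1 (N + k)| ^ p * ((N + k + 1 : ℕ) : ℝ) ^ α ≤ 2 ^ α * (1 / N) := by
      intro k hk
      rw [Finset.mem_range] at hk
      have h1 := Real.rpow_le_rpow (abs_nonneg _)
        (abs_trialFun_succ_sub_of_ge (γ := γ) hN (Nat.le_add_right N k)) hp0.le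
      have h2 : ((N + k + 1 : ℕ) : ℝ) ^ α ≤ (2 * N) ^ α := by
        refine Real.rpow_le_rpow (by positivity) ?_ hα
        exact_mod_cast (by omega : N + k + 1 ≤ 2 * N)
      have h4 : (N : ℝ) ^ ((γ - 1) * p) * (N : ℝ) ^ α = 1 / N := by
        rw [← Real.rpow_add hN0, one_div, ← Real.rpow_neg_one]
        congr 1; linear_combination hγ
      calc _ ≤ ((N : ℝ) ^ (γ - 1)) ^ p * (2 * N) ^ α := by
            simp only [trial_apply]; gcongr
        _ = 2 ^ α * (1 / N) := by
          rw [← Real.rpow_mul hN0.le, Real.mul_rpow (by norm_num) hN0.le, ← h4]; ring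
    refine (Finset.sum_le_sum hterm).trans (le_of_eq ?_)
    rw [Finset.sum_const, Finset.card_range, nsmul_eq_mul]
    field_simp

theorem le_weighted_trial {p α : ℝ} (hp : 1 < p) {γ : ℝ} (hγ : p * γ = p - 1 - α)
    (hγ0 : γ ≠ 0) (N : ℕ) :
    ∑ k ∈ Finset.range N, 1 / ((k : ℝ) + 1) ≤ weighted p (hardyWeight p α) (trial γ hγ0 N) := by
  refine le_trans (Finset.sum_le_sum fun k hk => ?_)
    ((summable_shift hp (trial γ hγ0 N) (hardyWeight p α)).sum_le_tsum (Finset.range N)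
      fun k _ => mul_nonneg (by positivity) (Real.rpow_nonneg (Nat.cast_nonneg _) _))
  rw [Finset.mem_range] at hk
  rw [trial_apply, trialFun, if_pos (by omega), hardyWeight]
  have hx : (0 : ℝ) < (k + 1 : ℕ) := by positivity
  rw [abs_of_pos (Real.rpow_pos_of_pos hx _), ← Real.rpow_mul hx.le, ← Real.rpow_add hx]
  refine le_of_eq ?_
  rw [one_div, ← Real.rpow_neg_one]
  push_cast
  congr 1; linear_combination -hγ

/-- The sharp constant in the discrete Hardy inequality. -/
theorem Adisc_eq {p α : ℝ} (hp : 1 < p) (hα : 0 ≤ α) (hαp : α ≠ p - 1) :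
    Adisc p α = |(p - 1 - α) / p| ^ p := by
  have hp0 : p ≠ 0 := by linarith
  set γ := (p - 1 - α) / p with hγdef
  have hγ : p * γ = p - 1 - α := by rw [hγdef]; field_simp
  have hγ0 : γ ≠ 0 := div_ne_zero (fun h => hαp (by linarith)) hp0
  obtain ⟨R, hR, h⟩ := exists_hardy hp hα hαp
  refine IsGreatest.csSup_eq ⟨fun u => ?_, fun A hA => ?_⟩
  · linarith [h u, weighted_nonneg p hR u]
  · by_contra! hlt
    have hA0 : 0 ≤ A := (Real.rpow_nonneg (abs_nonneg γ) p).trans hlt.le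
    set C := 1 + |γ| ^ p * (α * Real.exp α * ∑' k : ℕ, 1 / ((k : ℝ) + 1) ^ 2) + 2 ^ α
    obtain ⟨N, hN1, hN⟩ := ((Filter.eventually_ge_atTop 1).and
      (Real.tendsto_sum_range_one_div_nat_succ_atTop.eventually_gt_atTop
        (C / (A - |γ| ^ p)))).exists
    rw [div_lt_iff₀ (sub_pos.2 hlt)] at hN
    have h1 := mul_le_mul_of_nonneg_left (le_weighted_trial hp hγ hγ0 N) hA0
    have h2 := kinetic_trial_le hp hα hγ hγ0 hN1
    have h3 := hA (trial γ hγ0 N)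
    simp only [C] at hN
    linarith

/-! ### The weighted metric and stability -/

theorem mul_rpow_one_div_rpow {p : ℝ} (hp : 1 < p) {R : ℕ → ℝ} (hR : ∀ n, 1 ≤ n → 0 < R n)
    (u : H0 1) (k : ℕ) :
    (|u.1 (k + 1)| * R (k + 1) ^ (1 / p)) ^ p = |u.1 (k + 1)| ^ p * R (k + 1) := by
  have := (hR (k + 1) (by omega)).le
  rw [Real.mul_rpow (abs_nonneg _) (by positivity), ← Real.rpow_mul this,
    one_div_mul_cancel (by linarith), Real.rpow_one]

/-- Minkowski's inequality for the sequences `|u n| * R n ^ (1 / p)`. -/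
theorem weighted_add_rpow_le {p : ℝ} (hp : 1 < p) {R : ℕ → ℝ} (hR : ∀ n, 1 ≤ n → 0 < R n)
    (u v : H0 1) :
    weighted p R (u + v) ^ (1 / p) ≤ weighted p R u ^ (1 / p) + weighted p R v ^ (1 / p) := by
  have hnn : ∀ (u : H0 1) (k : ℕ), 0 ≤ |u.1 (k + 1)| * R (k + 1) ^ (1 / p) := fun u k =>
    mul_nonneg (abs_nonneg _) (Real.rpow_nonneg (hR _ (by omega)).le _)
  have hsum : ∀ u : H0 1, Summable fun k : ℕ => (|u.1 (k + 1)| * R (k + 1) ^ (1 / p)) ^ p :=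
    fun u => (summable_shift hp u R).congr fun k => (mul_rpow_one_div_rpow hp hR u k).symm
  have hw : ∀ u : H0 1,
      weighted p R u = ∑' k : ℕ, (|u.1 (k + 1)| * R (k + 1) ^ (1 / p)) ^ p :=
    fun u => tsum_congr fun k => (mul_rpow_one_div_rpow hp hR u k).symm
  have hle : ∀ k : ℕ, (|(u + v).1 (k + 1)| * R (k + 1) ^ (1 / p)) ^ p ≤
      (|u.1 (k + 1)| * R (k + 1) ^ (1 / p) + |v.1 (k + 1)| * R (k + 1) ^ (1 / p)) ^ p := fun k => by
    refine Real.rpow_le_rpow (hnn _ k) ?_ (by linarith)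
    rw [← add_mul]
    exact mul_le_mul_of_nonneg_right (abs_add_le _ _) (Real.rpow_nonneg (hR _ (by omega)).le _)
  obtain ⟨hs, hmink⟩ := Real.Lp_add_le_tsum_of_nonneg hp.le (hnn u) (hnn v) (hsum u) (hsum v)
  rw [hw u, hw v]
  refine le_trans (Real.rpow_le_rpow (weighted_nonneg p hR _) ?_ (by positivity)) hmink
  rw [hw]
  exact (hsum (u + v)).tsum_le_tsum hle hs

theorem weighted_zero {p : ℝ} (hp : 1 < p) (R : ℕ → ℝ) : weighted p R 0 = 0 := by
  have : p ≠ 0 := by linarith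
  simp [weighted, Real.zero_rpow this]

theorem weighted_sub_comm (p : ℝ) (R : ℕ → ℝ) (u v : H0 1) :
    weighted p R (u - v) = weighted p R (v - u) :=
  tsum_congr fun k => by
    have : |(u - v).1 (k + 1)| = |(v - u).1 (k + 1)| := abs_sub_comm _ _
    rw [this]

theorem eq_zero_of_weighted_eq_zero {p : ℝ} (hp : 1 < p) {R : ℕ → ℝ}
    (hR : ∀ n, 1 ≤ n → 0 < R n) {u : H0 1} (h : weighted p R u = 0) : u = 0 := by
  have hnn : ∀ k : ℕ, 0 ≤ |u.1 (k + 1)| ^ p * R (k + 1) := fun k =>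
    mul_nonneg (by positivity) (hR _ (by omega)).le
  have h0 := (hasSum_zero_iff_of_nonneg hnn).1 ((summable_shift hp u R).hasSum_iff.2 h)
  refine Subtype.ext (Finsupp.ext fun n => ?_)
  cases n with
  | zero => exact apply_zero u
  | succ k =>
    have hk : |u.1 (k + 1)| ^ p * R (k + 1) = 0 := congrFun h0 k
    have := (mul_eq_zero.1 hk).resolve_right (hR _ (by omega)).ne'
    exact abs_eq_zero.1 ((Real.rpow_eq_zero (abs_nonneg _) (by linarith)).1 this)

/-- The metric `d(u, v) = (∑ |u n - v n| ^ p * R n) ^ (1 / p)` on `H_0^1(ℕ)`, for a weight `R`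
positive on `n ≥ 1`. -/
noncomputable abbrev weightedMetric {p : ℝ} (hp : 1 < p) {R : ℕ → ℝ}
    (hR : ∀ n, 1 ≤ n → 0 < R n) : MetricSpace (H0 1) where
  dist u v := weighted p R (u - v) ^ (1 / p)
  dist_self u := by
    have : u - u = 0 := sub_self u
    rw [this, weighted_zero hp, Real.zero_rpow (one_div_ne_zero (by linarith))]
  dist_comm u v := by rw [weighted_sub_comm]
  dist_triangle u v w := by
    have : u - w = (u - v) + (v - w) := (sub_add_sub_cancel u v w).symm
    rw [this]
    exact weighted_add_rpow_le hp hR (u - v) (v - w)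
  eq_of_dist_eq_zero {u v} h := by
    rw [Real.rpow_eq_zero (weighted_nonneg p hR _) (one_div_ne_zero (by linarith))] at h
    exact sub_eq_zero.1 (eq_zero_of_weighted_eq_zero hp hR h)

theorem isRateFunction_rpow {p : ℝ} (hp : 1 < p) : IsRateFunction fun t : ℝ => t ^ p :=
  ⟨fun _ ht => Real.rpow_nonneg ht p, strictConvexOn_rpow hp, Real.zero_rpow (by linarith)⟩

/-- A remainder of the form `∑ |u n| ^ p * R n` yields stability: as `0` is an optimizer, the distance
to the optimizers is at most the distance to `0`. -/
theorem isStableWith_weightedMetric {p : ℝ} (hp : 1 < p) {R : ℕ → ℝ}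
    (hR : ∀ n, 1 ≤ n → 0 < R n) {E F : H0 1 → ℝ} (h0 : E 0 = F 0)
    (h : ∀ u, weighted p R u ≤ F u - E u) :
    IsStableWith (weightedMetric hp hR) (fun t : ℝ => t ^ p) E F := by
  refine ⟨isRateFunction_rpow hp, fun u => ?_, ⟨0, h0⟩, fun u => ?_⟩
  · linarith [h u, weighted_nonneg p hR u]
  · let _ := weightedMetric hp hR
    have h1 : Metric.infDist u (optimizers E F) ≤ weighted p R (u - 0) ^ (1 / p) :=
      Metric.infDist_le_dist_of_mem (x := u) h0
    have hu : u - 0 = u := sub_zero u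
    rw [hu] at h1
    refine le_trans (Real.rpow_le_rpow Metric.infDist_nonneg h1 (by linarith)) ?_
    rw [← Real.rpow_mul (weighted_nonneg p hR u), one_div_mul_cancel (by linarith), Real.rpow_one]
    exact h u

end DiscreteHardy

theorem theorem4p11 (p α : ℝ) (hp : 1 < p) (hα : 0 ≤ α) (hαp : α ≠ p - 1) :
    (∃ R : ℕ → ℝ, (∀ n, 1 ≤ n → 0 < R n) ∧
      (∀ u : DiscreteHardy.H0 1,
        DiscreteHardy.kinetic p α u
            - DiscreteHardy.Adisc p α *
              DiscreteHardy.weighted p (DiscreteHardy.hardyWeight p α) u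
          ≥ DiscreteHardy.weighted p R u) ∧
      -- stability for the metric of the weighted `ℓ^p` norm with weight `R`
      (∃ d : MetricSpace (DiscreteHardy.H0 1),
        (∀ u v : DiscreteHardy.H0 1,
          d.dist u v = (DiscreteHardy.weighted p R (u - v)) ^ (1 / p)) ∧
        DiscreteHardy.IsStableWith d (fun t : ℝ => t ^ p)
          (fun u => DiscreteHardy.Adisc p α *
            DiscreteHardy.weighted p (DiscreteHardy.hardyWeight p α) u)
          (DiscreteHardy.kinetic p α))) ∧
    DiscreteHardy.IsSubcritical p (DiscreteHardy.H0 1) (DiscreteHardy.energy p α) ∧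
    DiscreteHardy.IsStable (fun t : ℝ => t ^ p)
      (fun u => DiscreteHardy.Adisc p α *
        DiscreteHardy.weighted p (DiscreteHardy.hardyWeight p α) u)
      (DiscreteHardy.kinetic p α) := by
  obtain ⟨R, hR, h⟩ := DiscreteHardy.exists_hardy hp hα hαp
  rw [← DiscreteHardy.Adisc_eq hp hα hαp] at h
  have hs := DiscreteHardy.isStableWith_weightedMetric hp hR
    (E := fun u => DiscreteHardy.Adisc p α *
      DiscreteHardy.weighted p (DiscreteHardy.hardyWeight p α) u)
    (F := DiscreteHardy.kinetic p α)
    (by simp [DiscreteHardy.weighted_zero hp, DiscreteHardy.kinetic,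
      Real.zero_rpow (by linarith : p ≠ 0)])
    (fun u => by linarith [h u])
  refine ⟨⟨R, hR, fun u => by linarith [h u], _, fun u v => rfl, hs⟩,
    ⟨fun n => if n = 0 then 1 else R n, fun n => ?_, fun u => ?_⟩, _, hs⟩
  · dsimp only
    split_ifs with hn
    · exact one_pos
    · exact hR n (by omega)
  · -- The value of the weight at `0` is irrelevant because `u 0 = 0`.
    have : ∑' n : ℕ, |u.1 n| ^ p * (if n = 0 then 1 else R n) = DiscreteHardy.weighted p R u := by
      rw [(DiscreteHardy.summable_pow_mul hp u _).tsum_eq_zero_add, DiscreteHardy.apply_zero,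
        abs_zero, Real.zero_rpow (by linarith)]
      simp [DiscreteHardy.weighted]
    rw [this, DiscreteHardy.energy]
    linarith [h u]
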